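/- Conventions. A polygon $P\subset\mathbb C$ is the closed region bounded by a simple closed polygonal line with at least three vertices, and $\mathcal V_P$ is its finite set of vertices. Let $I=\{1,\dots,m\}$, let $I^*$ be the set of finite words over $I$ and $I^\infty$ the space of infinite words. For a system $\mathcal S=\{S_1,\dots,S_m\}$ of contracting similarities of $\mathbb C$ put $S_{\mathbf i}=S_{i_1}\circ\dots\circ S_{i_k}$ for $\mathbf i=i_1\dots i_k\in I^*$, $P_i=S_i(P)$ and $\mathcal V_{P_i}=S_i(\mathcal V_P)$. The attractor of $\mathcal S$ is the nonempty compact set $K$ with $K=\bigcup_i S_i(K)$, and its address map $\pi:I^\infty\to K$ sends $\alpha_1\alpha_2\dots$ to the unique point of $\bigcap_n S_{\alpha_1\dots\alpha_n}(K)$. The system $\mathcal S$ is a generalized $P$-polygonal system if (D2) for all $i\ne j$, $P_i\cap P_j=\mathcal V_{P_i}\cap\mathcal V_{P_j}$ and this set has fewer than two points; (D3) $\mathcal V_P\subset\bigcup_i\mathcal V_{P_i}$; (D4) $\bigcup_i P_i$ is contractible. It is a contractible $P$-polygonal system if moreover (D1) $P_i\subset P$ for all $i\in I$. For $\delta>0$,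 a generalized $P'$-polygonal system $\mathcal S'=\{S'_1,\dots,S'_m\}$ is a $\delta$-deformation of $\mathcal S$ if there is a bijection $f:\bigcup_k\mathcal V_{P_k}\to\bigcup_k\mathcal V_{P'_k}$ such that (a) $f(\mathcal V_P)=\mathcal V_{P'}$ and $f|_{\mathcal V_P}$ extends to a homeomorphism $P\to P'$; (b) $|f(x)-x|<\delta$ for all $x\in\bigcup_k\mathcal V_{P_k}$; (c) $f(S_k(x))=S'_k(f(x))$ for all $k\in I$, $x\in\mathcal V_P$. Theorem. Let $\mathcal S$ be a contractible $P$-polygonal system and let the generalized $P'$-polygonal system $\mathcal S'$ be a $\delta$-deformation of $\mathcal S$ for some $\delta>0$. Let $K,K'$ be the attractors of $\mathcal S,\mathcal S'$ and $\pi:I^\infty\to K$, $\pi':I^\infty\to K'$ the address maps. (i) There is a unique continuous map $\hat f:K\to K'$ with $\hat f\circ\pi=\pi'$. A continuous map $\hat f:K\to K'$ satisfies $\hat f\circ\pi=\pi'$ if and only if $\hat f(S_{\mathbf i}(z))=S'_{\mathbf i}(\hat f(z))$ for all $z\in K$ and $\mathbf i\in I^*$; in particular there is a unique continuous map with the latter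 property. The map $\hat f$ is Hölder continuous with some exponent in $(0,1]$. (ii) If $S'_i(K')\cap S'_j(K')=P'_i\cap P'_j$ for all $i,j\in I$ with $i\ne j$, then $\hat f$ is a homeomorphism of $K$ onto $K'$. -/

import Mathlib

open scoped NNReal

/-! ### Polygons in the plane -/

/-- The set of vertices of a polygon. -/
def polygonVertices {n : ℕ} (P : Polygon ℂ n) : Set ℂ := Set.range P.vertices

/-- A simple polygon: at least three vertices, pairwise distinct, and two different edges have no
common points other than common endpoints. -/
structure IsSimplePolygon {n : ℕ} (P : Polygon ℂ n) : Prop where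
  three_le : 3 ≤ n
  injective : Function.Injective P.vertices
  edges : ∀ i j : Fin n, i ≠ j →
    P.edgeSet ℝ i ∩ P.edgeSet ℝ j ⊆
      ({P.vertices i, P.vertices (finRotate n i)} : Set ℂ) ∩
        {P.vertices j, P.vertices (finRotate n j)}

/-- The closed region bounded by a polygon: the boundary line together with the bounded
connected components of its complement. -/
def polygonRegion {n : ℕ} (P : Polygon ℂ n) : Set ℂ :=
  P.boundary ℝ ∪
    {z | z ∉ P.boundary ℝ ∧ Bornology.IsBounded (connectedComponentIn (P.boundary ℝ)ᶜ z)}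

/-! ### Self-similar sets -/

/-- A contracting similarity of the plane, of ratio `q` with `0 < q < 1`. -/
def IsContractingSimilarity (T : ℂ → ℂ) : Prop :=
  ∃ q : ℝ, 0 < q ∧ q < 1 ∧ ∀ x y : ℂ, dist (T x) (T y) = q * dist x y

/-- `K` is the attractor of the system `S`. -/
structure IsAttractor {m : ℕ} (S : Fin m → ℂ → ℂ) (K : Set ℂ) : Prop where
  nonempty : K.Nonempty
  isCompact : IsCompact K
  eq_iUnion : K = ⋃ i, S i '' K

/-- For a finite word `w = w₁ w₂ … wₖ`, the map `S_{w₁} ∘ S_{w₂} ∘ ⋯ ∘ S_{wₖ}`. -/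
def wordMap {m : ℕ} (S : Fin m → ℂ → ℂ) : List (Fin m) → ℂ → ℂ
  | [] => id
  | i :: w => S i ∘ wordMap S w

theorem IsAttractor.wordMap_mem {m : ℕ} {S : Fin m → ℂ → ℂ} {K : Set ℂ} (hK : IsAttractor S K)
    (w : List (Fin m)) {z : ℂ} (hz : z ∈ K) : wordMap S w z ∈ K := by
  induction w with
  | nil => exact hz
  | cons i w ih =>
    rw [hK.eq_iUnion]
    exact Set.mem_iUnion.2 ⟨i, Set.mem_image_of_mem _ ih⟩

/-- `π` is the address map of the system `S` with attractor `K`: it sends the infinite word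
`α = α₁ α₂ …` (indexed from `0`) to the only point of the intersection of the pieces
`K_{α₁ … αₖ}`. -/
def IsAddressMap {m : ℕ} (S : Fin m → ℂ → ℂ) (K : Set ℂ) (π : (ℕ → Fin m) → K) : Prop :=
  ∀ α : ℕ → Fin m, ⋂ k : ℕ, wordMap S ((List.range k).map α) '' K = {(π α : ℂ)}

/-! ### Polygonal systems -/

/-- A generalized `P`-polygonal system of (contracting) similarities. -/
structure IsGeneralizedPolygonalSystem {m n : ℕ} (P : Polygon ℂ n) (S : Fin m → ℂ → ℂ) :
    Prop where
  simple : IsSimplePolygon P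
  similarity : ∀ i, IsContractingSimilarity (S i)
  inter_eq : ∀ i j, i ≠ j →
    S i '' polygonRegion P ∩ S j '' polygonRegion P =
      S i '' polygonVertices P ∩ S j '' polygonVertices P
  encard_lt : ∀ i j, i ≠ j → (S i '' polygonVertices P ∩ S j '' polygonVertices P).encard < 2
  vertices_subset : polygonVertices P ⊆ ⋃ i, S i '' polygonVertices P
  contractible : ContractibleSpace ↥(⋃ i, S i '' polygonRegion P)

/-- A contractible `P`-polygonal system of similarities. -/
structure IsContractiblePolygonalSystem {m n : ℕ} (P : Polygon ℂ n) (S : Fin m → ℂ → ℂ) : Prop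
    extends IsGeneralizedPolygonalSystem P S where
  image_subset : ∀ i, S i '' polygonRegion P ⊆ polygonRegion P

/-- The generalized `P'`-polygonal system `S'` is a `δ`-deformation of the `P`-polygonal system
`S`. -/
structure IsDeformation {m n n' : ℕ} (δ : ℝ) (P : Polygon ℂ n) (S : Fin m → ℂ → ℂ)
    (P' : Polygon ℂ n') (S' : Fin m → ℂ → ℂ) : Prop where
  pos : 0 < δ
  generalized : IsGeneralizedPolygonalSystem P' S'
  exists_map : ∃ f : ℂ → ℂ,
    Set.BijOn f (⋃ k, S k '' polygonVertices P) (⋃ k, S' k '' polygonVertices P') ∧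
    f '' polygonVertices P = polygonVertices P' ∧
    (∃ h : polygonRegion P ≃ₜ polygonRegion P',
      ∀ x : polygonRegion P, (x : ℂ) ∈ polygonVertices P → (h x : ℂ) = f x) ∧
    (∀ x ∈ ⋃ k, S k '' polygonVertices P, ‖f x - x‖ < δ) ∧
    (∀ k, ∀ x ∈ polygonVertices P, f (S k x) = S' k (f x))

/-- Different pieces of the attractor `K` meet exactly where the polygons do. -/
def IntersectionCondition {m n : ℕ} (P : Polygon ℂ n) (S : Fin m → ℂ → ℂ) (K : Set ℂ) : Prop :=
  ∀ i j, i ≠ j → S i '' K ∩ S j '' K = S i '' polygonRegion P ∩ S j '' polygonRegion P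

/-- `f (S_w z) = S'_w (f z)` for all `z ∈ K` and all finite words `w`. -/
def Intertwines {m : ℕ} {S : Fin m → ℂ → ℂ} (S' : Fin m → ℂ → ℂ) {K K' : Set ℂ}
    (hK : IsAttractor S K)
    (f : K → K') : Prop :=
  ∀ (w : List (Fin m)) (z : K),
    (f ⟨wordMap S w z, hK.wordMap_mem w z.2⟩ : ℂ) = wordMap S' w (f z)

/-! Everything rests on one inequality, `dist (π' α) (π' β) ≤ C * dist (π α) (π β) ^ r` for all
words. It makes `π'` constant on the fibres of the surjection `π`, so `π'` factors through `π` by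
exactly one map, and that map is Hölder.

The exponent is chosen so that the contraction ratios satisfy `q' i ≤ q i ^ r`. The inequality then
survives prefixing a letter to both words, so only words with distinct first letters `i`, `j`
matter. If the two pieces of `K` are disjoint, their distance is bounded below. Otherwise the
polygons share exactly one point, a common vertex `p`. Straight edges cannot be tangent there
(`separatedAt_image_polygonRegion`), so both points lie within a multiple of their mutual distance
from `p`, and it remains to compare a point with a vertex (`exists_dist_vertex_le`). Letters can be
peeled off there too: a vertex of `P` in `S i '' K` is the `S i`-image of a vertex, and the
deformation respects this.

For the homeomorphism, the intersection condition lets the same peeling run from `S'` back to `S`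
(`IsDeformation.address_eq`). This gives injectivity, and compactness does the rest. -/

/-! ### Non-tangency of polygons at a common point. -/

section Separation

open Set Filter Topology

/-- The point `x ∈ A` is not much further from `p` than from any point of `B`: the sets `A` and `B`
are not tangent at `p`. -/
def SeparatedAt (p : ℂ) (A B : Set ℂ) : Prop :=
  ∃ C : ℝ, ∀ x ∈ A, ∀ y ∈ B, dist x p ≤ C * dist x y

theorem SeparatedAt.mono {p : ℂ} {A A' B B' : Set ℂ} (h : SeparatedAt p A B) (hA : A' ⊆ A)
    (hB : B' ⊆ B) : SeparatedAt p A' B' :=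
  h.imp fun _ hC x hx y hy => hC x (hA hx) y (hB hy)

theorem SeparatedAt.iUnion {ι κ : Type*} [Finite ι] [Finite κ] {p : ℂ} {A : ι → Set ℂ}
    {B : κ → Set ℂ} (h : ∀ i j, SeparatedAt p (A i) (B j)) :
    SeparatedAt p (⋃ i, A i) (⋃ j, B j) := by
  have h' : ∀ i j, ∀ᶠ C : ℝ in atTop, ∀ x ∈ A i, ∀ y ∈ B j, dist x p ≤ C * dist x y := by
    intro i j
    obtain ⟨C, hC⟩ := h i j
    filter_upwards [eventually_ge_atTop C] with D hD x hx y hy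
    exact (hC x hx y hy).trans (by gcongr)
  obtain ⟨C, hC⟩ := (eventually_all.2 fun i => eventually_all.2 (h' i)).exists
  refine ⟨C, fun x hx y hy => ?_⟩
  obtain ⟨i, hi⟩ := mem_iUnion.1 hx
  obtain ⟨j, hj⟩ := mem_iUnion.1 hy
  exact hC i j x hi y hj

theorem SeparatedAt.union {p : ℂ} {A A' B B' : Set ℂ} (h₁ : SeparatedAt p A B)
    (h₂ : SeparatedAt p A B') (h₃ : SeparatedAt p A' B) (h₄ : SeparatedAt p A' B') :
    SeparatedAt p (A ∪ A') (B ∪ B') := by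
  rw [union_eq_iUnion, union_eq_iUnion]
  refine .iUnion fun i j => ?_
  cases i <;> cases j <;> assumption

theorem IsCompact.exists_pos_forall_le_dist {A B : Set ℂ} (hA : IsCompact A) (hB : IsClosed B)
    (h : Disjoint A B) : ∃ d : ℝ, 0 < d ∧ ∀ x ∈ A, ∀ y ∈ B, d ≤ dist x y := by
  obtain ⟨r, hr, h⟩ := Metric.exists_pos_forall_lt_edist hA hB h
  refine ⟨r, hr, fun x hx y hy => ?_⟩
  have := h x hx y hy
  rw [edist_nndist, ENNReal.coe_lt_coe] at this
  exact_mod_cast this.le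

theorem SeparatedAt.of_disjoint {A B : Set ℂ} (p : ℂ) (hA : IsCompact A) (hB : IsClosed B)
    (h : Disjoint A B) : SeparatedAt p A B := by
  obtain ⟨d, hd, h⟩ := hA.exists_pos_forall_le_dist hB h
  obtain ⟨R, hR⟩ := hA.isBounded.subset_closedBall p
  refine ⟨R / d, fun x hx y hy => ?_⟩
  have h₁ : dist x p ≤ R := hR hx
  have h₂ : 0 ≤ R := dist_nonneg.trans h₁
  calc dist x p ≤ R / d * d := by rwa [div_mul_cancel₀ _ hd.ne']
    _ ≤ R / d * dist x y := by gcongr; exact h x hx y hy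

/-- For `x = p + s • u` and `y = p + t • v` both distances are homogeneous in `(s, t)`, so it
suffices to bound `‖s • u - t • v‖` below on the compact set `max s t = 1`, where it does not
vanish. -/
theorem separatedAt_segment_left {p a b : ℂ} (h : segment ℝ p a ∩ segment ℝ p b ⊆ {p}) :
    SeparatedAt p (segment ℝ p a) (segment ℝ p b) := by
  set u := a - p
  set v := b - p
  have hu : ∀ s ∈ Icc (0 : ℝ) 1, p + s • u ∈ segment ℝ p a := fun s hs => by
    rw [segment_eq_image']; exact ⟨s, hs, rfl⟩
  have hv : ∀ s ∈ Icc (0 : ℝ) 1, p + s • v ∈ segment ℝ p b := fun s hs => by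
    rw [segment_eq_image']; exact ⟨s, hs, rfl⟩
  by_cases hu0 : u = 0
  · have : a = p := sub_eq_zero.1 hu0
    refine ⟨0, fun x hx y _ => ?_⟩
    rw [this, segment_same] at hx
    simp [mem_singleton_iff.1 hx]
  by_cases hv0 : v = 0
  · have : b = p := sub_eq_zero.1 hv0
    refine ⟨1, fun x _ y hy => ?_⟩
    rw [this, segment_same] at hy
    simp [mem_singleton_iff.1 hy]
  let S : Set (ℝ × ℝ) := {z | z ∈ Icc (0 : ℝ) 1 ×ˢ Icc (0 : ℝ) 1 ∧ max z.1 z.2 = 1}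
  have hS : IsCompact S :=
    (isCompact_Icc.prod isCompact_Icc).inter_right (isClosed_eq (by fun_prop) continuous_const)
  obtain ⟨z, hz, hmin⟩ := hS.exists_isMinOn ⟨(1, 1), by simp [S]⟩
    (f := fun z => ‖z.1 • u - z.2 • v‖) (by fun_prop)
  set m := ‖z.1 • u - z.2 • v‖
  have hm : 0 < m := by
    refine norm_pos_iff.2 fun h0 => ?_
    have h1 : p + z.1 • u = p + z.2 • v := by rw [sub_eq_zero.1 h0]
    have h2 : p + z.1 • u = p := h ⟨hu _ hz.1.1, h1 ▸ hv _ hz.1.2⟩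
    have h3 : z.1 = 0 := by simpa [hu0] using h2
    have h4 : z.2 = 0 := by simpa [hv0] using h1.symm.trans h2
    have := hz.2
    simp [h3, h4] at this
  refine ⟨‖u‖ / m, fun x hx y hy => ?_⟩
  rw [segment_eq_image'] at hx hy
  obtain ⟨s, hs, rfl⟩ := hx
  obtain ⟨t, ht, rfl⟩ := hy
  have key : max s t * m ≤ ‖s • u - t • v‖ := by
    rcases eq_or_lt_of_le (le_max_of_le_left hs.1 : (0 : ℝ) ≤ max s t) with h0 | h0
    · rw [← h0, zero_mul]; positivity
    · have hmem : ((s / max s t, t / max s t) : ℝ × ℝ) ∈ S := by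
        refine ⟨⟨⟨div_nonneg hs.1 h0.le, (div_le_one h0).2 (le_max_left _ _)⟩,
          ⟨div_nonneg ht.1 h0.le, (div_le_one h0).2 (le_max_right _ _)⟩⟩, ?_⟩
        change max (s / max s t) (t / max s t) = 1
        rw [max_div_div_right h0.le, div_self h0.ne']
      have h1 := hmin hmem
      calc max s t * m ≤ max s t * ‖(s / max s t) • u - (t / max s t) • v‖ := by gcongr; exact h1
        _ = ‖(max s t) • ((s / max s t) • u - (t / max s t) • v)‖ := by
          rw [norm_smul, Real.norm_of_nonneg h0.le]
        _ = ‖s • u - t • v‖ := by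
          rw [smul_sub, smul_smul, smul_smul, mul_div_cancel₀ _ h0.ne', mul_div_cancel₀ _ h0.ne']
  have h1 : dist (p + s • u) p = s * ‖u‖ := by
    rw [dist_eq_norm, add_sub_cancel_left, norm_smul, Real.norm_of_nonneg hs.1]
  have h2 : dist (p + s • u) (p + t • v) = ‖s • u - t • v‖ := by
    rw [dist_eq_norm, add_sub_add_left_eq_sub]
  change dist (p + s • u) p ≤ _ * dist (p + s • u) (p + t • v)
  rw [h1, h2, div_mul_eq_mul_div, le_div_iff₀ hm]
  calc s * ‖u‖ * m = ‖u‖ * (s * m) := by ring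
    _ ≤ ‖u‖ * ‖s • u - t • v‖ := by
      gcongr
      exact le_trans (by gcongr; exact le_max_left _ _) key

theorem segment_subset_union_of_mem {p a b : ℂ} (h : p ∈ segment ℝ a b) :
    segment ℝ a b ⊆ segment ℝ p a ∪ segment ℝ p b ∧
      segment ℝ p a ∪ segment ℝ p b ⊆ segment ℝ a b := by
  refine ⟨?_, union_subset ((convex_segment a b).segment_subset h (left_mem_segment ..))
    ((convex_segment a b).segment_subset h (right_mem_segment ..))⟩
  rw [segment_eq_image_lineMap] at h
  obtain ⟨s, hs, rfl⟩ := h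
  intro x hx
  rw [segment_eq_image_lineMap] at hx
  obtain ⟨t, ht, rfl⟩ := hx
  have key : ∀ r : ℝ, t ∈ segment ℝ s r →
      AffineMap.lineMap a b t ∈ segment ℝ (AffineMap.lineMap a b s) (AffineMap.lineMap a b r) := by
    intro r hr
    rw [← image_segment]
    exact mem_image_of_mem _ hr
  rcases le_total t s with hts | hts
  · left
    have := key 0 (by rw [segment_symm, segment_eq_Icc hs.1]; exact ⟨ht.1, hts⟩)
    simpa using this
  · right
    have := key 1 (by rw [segment_eq_Icc hs.2]; exact ⟨hts, ht.2⟩)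
    simpa using this

theorem isCompact_segment (a b : ℂ) : IsCompact (segment ℝ a b) := by
  rw [segment_eq_image_lineMap]
  exact isCompact_Icc.image AffineMap.lineMap_continuous

theorem separatedAt_segment {p a b c d : ℂ} (h : segment ℝ a b ∩ segment ℝ c d ⊆ {p}) :
    SeparatedAt p (segment ℝ a b) (segment ℝ c d) := by
  by_cases hp : p ∈ segment ℝ a b ∩ segment ℝ c d
  · obtain ⟨h₁, h₁'⟩ := segment_subset_union_of_mem hp.1
    obtain ⟨h₂, h₂'⟩ := segment_subset_union_of_mem hp.2
    obtain ⟨h₁l, h₁r⟩ := union_subset_iff.1 h₁'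
    obtain ⟨h₂l, h₂r⟩ := union_subset_iff.1 h₂'
    exact (SeparatedAt.union
      (separatedAt_segment_left ((inter_subset_inter h₁l h₂l).trans h))
      (separatedAt_segment_left ((inter_subset_inter h₁l h₂r).trans h))
      (separatedAt_segment_left ((inter_subset_inter h₁r h₂l).trans h))
      (separatedAt_segment_left ((inter_subset_inter h₁r h₂r).trans h))).mono h₁ h₂
  · refine .of_disjoint p (isCompact_segment a b) (isCompact_segment c d).isClosed ?_
    refine disjoint_iff_inter_eq_empty.2 (eq_empty_of_forall_notMem fun x hx => ?_)
    exact hp (mem_singleton_iff.1 (h hx) ▸ hx)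

/-- Every segment that leaves `A` meets `B`. -/
def Fences (B A : Set ℂ) : Prop :=
  ∀ x ∈ A, ∀ y ∉ A, ∃ z ∈ segment ℝ x y, z ∈ B

/-- On the way from `x` to `y` the segment leaves `A` at some `z ∈ B`; going back from `y` to `z` it
leaves `A'` at some `w ∈ B'`. Separation of `z` and `w` controls `dist z p`. If either exit is
missing, the point concerned is `p` itself. -/
theorem SeparatedAt.of_fences {p : ℂ} {A A' B B' : Set ℂ} (hA : Fences B A) (hA' : Fences B' A')
    (hB : B ⊆ A) (h : A ∩ A' ⊆ {p}) (hs : SeparatedAt p B B') :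
    SeparatedAt p A A' := by
  obtain ⟨C, hC⟩ := hs
  have add : ∀ {a b z : ℂ}, z ∈ segment ℝ a b → dist a z + dist z b = dist a b :=
    fun hz => dist_add_dist_of_mem_segment hz
  refine ⟨1 + max C 1, fun x hx y hy => ?_⟩
  obtain ⟨z, hz, hzp⟩ : ∃ z ∈ segment ℝ x y, dist z p ≤ max C 1 * dist z y := by
    by_cases hyA : y ∈ A
    · refine ⟨y, right_mem_segment .., ?_⟩
      rw [mem_singleton_iff.1 (h ⟨hyA, hy⟩)]
      simp
    obtain ⟨z, hz, hzB⟩ := hA x hx y hyA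
    refine ⟨z, hz, ?_⟩
    by_cases hzA' : z ∈ A'
    · rw [mem_singleton_iff.1 (h ⟨hB hzB, hzA'⟩), dist_self]
      positivity
    obtain ⟨w, hw, hwB⟩ := hA' y hy z hzA'
    have h₁ := add hw
    calc dist z p ≤ C * dist z w := hC z hzB w hwB
      _ ≤ max C 1 * dist z y := by
        gcongr
        · exact le_max_left _ _
        · rw [dist_comm z w, dist_comm z y]; linarith [dist_nonneg (x := y) (y := w)]
  have h₁ := add hz
  have h₂ : dist z y ≤ dist x y := by linarith [dist_nonneg (x := x) (y := z)]
  calc dist x p ≤ dist x z + dist z p := dist_triangle ..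
    _ ≤ dist x y + max C 1 * dist x y := by
      refine add_le_add (by linarith [dist_nonneg (x := z) (y := y)]) (hzp.trans ?_)
      gcongr
    _ = (1 + max C 1) * dist x y := by ring

/-- A segment that avoids the boundary stays in one component of its complement. -/
theorem fences_polygonRegion {n : ℕ} (P : Polygon ℂ n) :
    Fences (P.boundary ℝ) (polygonRegion P) := by
  intro x hx y hy
  by_contra! hxy
  refine hy (.inr ⟨hxy y (right_mem_segment ..), ?_⟩)
  have hxB := hxy x (left_mem_segment ..)
  have hxb := (hx.resolve_left hxB).2
  have : y ∈ connectedComponentIn (P.boundary ℝ)ᶜ x :=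
    (convex_segment x y).isPreconnected.subset_connectedComponentIn (left_mem_segment ..) hxy
      (right_mem_segment ..)
  rwa [← connectedComponentIn_eq this]

theorem isClosed_polygonBoundary {n : ℕ} (P : Polygon ℂ n) : IsClosed (P.boundary ℝ) := by
  refine isClosed_iUnion_of_finite fun i => ?_
  rw [Polygon.edgeSet, affineSegment_eq_segment]
  exact (isCompact_segment _ _).isClosed

theorem isClosed_polygonRegion {n : ℕ} (P : Polygon ℂ n) : IsClosed (polygonRegion P) := by
  rw [← isOpen_compl_iff, isOpen_iff_mem_nhds]
  intro z hz
  obtain ⟨h₁, h₂⟩ := not_or.1 hz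
  have hz' : z ∈ (P.boundary ℝ)ᶜ := h₁
  filter_upwards [(isClosed_polygonBoundary P).isOpen_compl.connectedComponentIn.mem_nhds
    (mem_connectedComponentIn hz')] with w hw
  rintro (h | h)
  · exact connectedComponentIn_subset _ _ hw h
  · exact h₂ ⟨h₁, (connectedComponentIn_eq hw) ▸ h.2⟩

theorem polygonVertices_subset_polygonRegion {n : ℕ} (P : Polygon ℂ n) :
    polygonVertices P ⊆ polygonRegion P := by
  rintro _ ⟨i, rfl⟩
  exact .inl (mem_iUnion.2 ⟨i, left_mem_affineSegment ..⟩)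

/-- Divided by its ratio, `T` is an isometry of a strictly convex space, hence affine, and bijective
by equality of dimensions. -/
theorem IsContractingSimilarity.exists_affineEquiv {T : ℂ → ℂ} (hT : IsContractingSimilarity T) :
    ∃ e : ℂ ≃ᵃ[ℝ] ℂ, ⇑e = T := by
  obtain ⟨q, hq, -, h⟩ := hT
  have hi : Isometry fun x => q⁻¹ • T x := by
    refine Isometry.of_dist_eq fun x y => ?_
    rw [dist_smul₀, h, Real.norm_of_nonneg (inv_nonneg.2 hq.le), inv_mul_cancel_left₀ hq.ne']
  let e := hi.affineIsometryOfStrictConvexSpace.toAffineIsometryEquiv rfl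
  refine ⟨e.toAffineEquiv.trans
    (LinearEquiv.smulOfNeZero ℝ ℂ q hq.ne').toAffineEquiv, funext fun x => ?_⟩
  change q • (q⁻¹ • T x) = T x
  rw [smul_inv_smul₀ hq.ne']

theorem Fences.image {A B : Set ℂ} (h : Fences B A) (e : ℂ ≃ᵃ[ℝ] ℂ) :
    Fences (e '' B) (e '' A) := by
  rintro _ ⟨x, hx, rfl⟩ y hy
  obtain ⟨y, rfl⟩ := e.surjective y
  obtain ⟨z, hz, hzB⟩ := h x hx y fun hyA => hy (mem_image_of_mem _ hyA)
  exact ⟨e z, by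
    have := image_segment ℝ e.toAffineMap x y
    simp only [AffineEquiv.coe_toAffineMap] at this
    exact this ▸ mem_image_of_mem _ hz, mem_image_of_mem _ hzB⟩

theorem separatedAt_image_polygonRegion {n n' : ℕ} {P : Polygon ℂ n} {P' : Polygon ℂ n'}
    {T T' : ℂ → ℂ} (hT : IsContractingSimilarity T) (hT' : IsContractingSimilarity T') {p : ℂ}
    (h : T '' polygonRegion P ∩ T' '' polygonRegion P' = {p}) :
    SeparatedAt p (T '' polygonRegion P) (T' '' polygonRegion P') := by
  obtain ⟨e, rfl⟩ := hT.exists_affineEquiv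
  obtain ⟨e', rfl⟩ := hT'.exists_affineEquiv
  have image_boundary : ∀ {k : ℕ} (Q : Polygon ℂ k) (g : ℂ ≃ᵃ[ℝ] ℂ), g '' Q.boundary ℝ =
      ⋃ i, segment ℝ (g (Q i)) (g (Q (finRotate k i))) := by
    intro k Q g
    rw [Polygon.boundary, image_iUnion]
    refine iUnion_congr fun i => ?_
    rw [Polygon.edgeSet, affineSegment_eq_segment]
    exact image_segment ℝ g.toAffineMap _ _
  have sub : ∀ {k : ℕ} (Q : Polygon ℂ k) (g : ℂ ≃ᵃ[ℝ] ℂ),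
      g '' Q.boundary ℝ ⊆ g '' polygonRegion Q := fun Q g => image_mono subset_union_left
  refine .of_fences ((fences_polygonRegion P).image e) ((fences_polygonRegion P').image e')
    (sub P e) h.subset ?_
  have h' := (inter_subset_inter (sub P e) (sub P' e')).trans h.subset
  rw [image_boundary, image_boundary] at h' ⊢
  refine .iUnion fun i j => separatedAt_segment ?_
  exact (inter_subset_inter (subset_iUnion_of_subset i subset_rfl)
    (subset_iUnion_of_subset j subset_rfl)).trans h'

end Separation

/-! ### Words, addresses and intertwining maps. -/

section Addresses

open Set Filter Topology

variable {m : ℕ} {S : Fin m → ℂ → ℂ} {K : Set ℂ} {π : (ℕ → Fin m) → K}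

/-- The left shift of an infinite word. -/
def wordShift (α : ℕ → Fin m) : ℕ → Fin m := fun k => α (k + 1)

/-- The infinite word that starts with the letter `i` and goes on as `α`. -/
def wordCons (i : Fin m) (α : ℕ → Fin m) : ℕ → Fin m := fun k => Nat.casesOn k i α

theorem wordMap_range_succ (S : Fin m → ℂ → ℂ) (α : ℕ → Fin m) (k : ℕ) :
    wordMap S ((List.range (k + 1)).map α) =
      S (α 0) ∘ wordMap S ((List.range k).map (wordShift α)) := by
  rw [List.range_succ_eq_map, List.map_cons, List.map_map]
  rfl

theorem IsContractingSimilarity.injective {T : ℂ → ℂ} (hT : IsContractingSimilarity T) :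
    Function.Injective T := by
  obtain ⟨e, rfl⟩ := hT.exists_affineEquiv
  exact e.injective

theorem IsContractingSimilarity.continuous {T : ℂ → ℂ} (hT : IsContractingSimilarity T) :
    Continuous T := by
  obtain ⟨e, rfl⟩ := hT.exists_affineEquiv
  exact e.toAffineMap.continuous_of_finiteDimensional

theorem IsAttractor.mem (hK : IsAttractor S K) (i : Fin m) {x : ℂ} (hx : x ∈ K) : S i x ∈ K :=
  hK.wordMap_mem [i] hx

theorem IsAttractor.exists_eq (hK : IsAttractor S K) {x : ℂ} (hx : x ∈ K) :
    ∃ i, ∃ y ∈ K, S i y = x :=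
  mem_iUnion.1 (hK.eq_iUnion.subset hx)

/-- A bounded set that is covered by its images is contained in every nonempty closed set that
contains its own images. -/
theorem subset_of_subset_iUnion_image (hS : ∀ i, IsContractingSimilarity (S i)) {A B : Set ℂ}
    (hA : Bornology.IsBounded A) (hAS : A ⊆ ⋃ i, S i '' A) (hB : IsClosed B) (hne : B.Nonempty)
    (hBS : ∀ i, MapsTo (S i) B B) : A ⊆ B := by
  choose q hq0 hq1 hq using hS
  obtain ⟨b, hb⟩ := hne
  obtain ⟨R, hR⟩ := hA.subset_closedBall b
  intro x hx
  have : Nonempty (Fin m) := ⟨(mem_iUnion.1 (hAS hx)).choose⟩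
  obtain ⟨i₀, hi₀⟩ := Finite.exists_max q
  -- Pull `x` back `n` times inside `A`, replace the result by `b`, and push forward again.
  have key : ∀ n : ℕ, ∀ x ∈ A, ∃ z ∈ B, dist x z ≤ q i₀ ^ n * R := by
    intro n
    induction n with
    | zero => exact fun x hx => ⟨b, hb, by simpa using hR hx⟩
    | succ n ih =>
      intro x hx
      obtain ⟨i, y, hy, rfl⟩ := mem_iUnion.1 (hAS hx)
      obtain ⟨z, hz, hyz⟩ := ih y hy
      refine ⟨S i z, hBS i hz, ?_⟩
      rw [hq, pow_succ', mul_assoc]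
      exact mul_le_mul (hi₀ i) hyz dist_nonneg (hq0 i₀).le
  have hlim : Tendsto (fun n : ℕ => q i₀ ^ n * R) atTop (𝓝 0) := by
    simpa using (tendsto_pow_atTop_nhds_zero_of_lt_one (hq0 i₀).le (hq1 i₀)).mul_const R
  rw [← hB.closure_eq, Metric.mem_closure_iff]
  intro ε hε
  obtain ⟨n, hn⟩ := (hlim.eventually_lt_const hε).exists
  obtain ⟨z, hz, h⟩ := key n x hx
  exact ⟨z, hz, h.trans_lt hn⟩

theorem IsAddressMap.eq_of_forall_mem (hπ : IsAddressMap S K π) {α : ℕ → Fin m} {x : ℂ}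
    (h : ∀ k, x ∈ wordMap S ((List.range k).map α) '' K) : x = π α := by
  rw [← mem_singleton_iff, ← hπ α]
  exact mem_iInter.2 h

theorem IsAddressMap.mem (hπ : IsAddressMap S K π) (α : ℕ → Fin m) (k : ℕ) :
    (π α : ℂ) ∈ wordMap S ((List.range k).map α) '' K :=
  mem_iInter.1 ((hπ α).symm.subset (mem_singleton _)) k

/-- A point can be recognised as `π α` by an invariant relation between words and points. -/
theorem IsAddressMap.eq_of_rel (hπ : IsAddressMap S K π) {R : (ℕ → Fin m) → ℂ → Prop}
    (hRK : ∀ α x, R α x → x ∈ K)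
    (hR : ∀ α x, R α x → ∃ y, R (wordShift α) y ∧ S (α 0) y = x) {α : ℕ → Fin m} {x : ℂ}
    (h : R α x) : x = π α := by
  refine hπ.eq_of_forall_mem fun k => ?_
  induction k generalizing α x with
  | zero => exact ⟨x, hRK α x h, rfl⟩
  | succ k ih =>
    obtain ⟨y, hy, rfl⟩ := hR α x h
    rw [wordMap_range_succ, image_comp]
    exact mem_image_of_mem _ (ih hy)

theorem IsAddressMap.apply_shift (hπ : IsAddressMap S K π) (hK : IsAttractor S K)
    (α : ℕ → Fin m) : S (α 0) (π (wordShift α)) = π α := by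
  refine hπ.eq_of_forall_mem fun k => ?_
  cases k with
  | zero => exact ⟨_, hK.mem _ (π _).2, rfl⟩
  | succ k =>
    rw [wordMap_range_succ, image_comp]
    exact mem_image_of_mem _ (hπ.mem _ k)

theorem IsAddressMap.apply_cons (hπ : IsAddressMap S K π) (hK : IsAttractor S K) (i : Fin m)
    (α : ℕ → Fin m) : (π (wordCons i α) : ℂ) = S i (π α) :=
  (hπ.apply_shift hK (wordCons i α)).symm

theorem IsAddressMap.surjective (hπ : IsAddressMap S K π) (hK : IsAttractor S K) :
    Function.Surjective π := by
  have h : ∀ x : K, ∃ i, ∃ y : K, S i y = x := fun x => by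
    obtain ⟨i, y, hy, h⟩ := hK.exists_eq x.2
    exact ⟨i, ⟨y, hy⟩, h⟩
  choose a b hab using h
  intro x
  -- The word records the letters along a backward orbit of `x` under the chosen preimages `b`.
  refine ⟨fun k => a (b^[k] x), Subtype.ext (Eq.symm ?_)⟩
  refine hπ.eq_of_rel (R := fun α y => ∃ z : K, y = z ∧ α = fun k => a (b^[k] z)) ?_ ?_
    ⟨x, rfl, rfl⟩
  · rintro _ _ ⟨z, rfl, -⟩
    exact z.2
  · rintro _ _ ⟨z, rfl, rfl⟩
    exact ⟨b z, ⟨b z, rfl, rfl⟩, hab z⟩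

/-- Maps between attractors that preserve addresses are the intertwining maps. -/
theorem comp_eq_iff_intertwines {S' : Fin m → ℂ → ℂ} {K' : Set ℂ} {π' : (ℕ → Fin m) → K'}
    (hK : IsAttractor S K) (hK' : IsAttractor S' K') (hπ : IsAddressMap S K π)
    (hπ' : IsAddressMap S' K' π') (f : K → K') : f ∘ π = π' ↔ Intertwines S' hK f := by
  constructor
  · intro h w z
    induction w with
    | nil => rfl
    | cons i w ih =>
      obtain ⟨α, hα⟩ := hπ.surjective hK ⟨_, hK.wordMap_mem w z.2⟩
      have h₁ : (⟨wordMap S (i :: w) z, hK.wordMap_mem (i :: w) z.2⟩ : K) =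
          π (wordCons i α) := by
        rw [Subtype.ext_iff, hπ.apply_cons hK, hα]
        rfl
      rw [h₁, ← Function.comp_apply (f := f), h, hπ'.apply_cons hK', ← h, Function.comp_apply, hα,
        ih]
      rfl
  · intro h
    funext α
    refine Subtype.ext (hπ'.eq_of_forall_mem fun k => ?_)
    obtain ⟨z, hz, hzα⟩ := hπ.mem α k
    refine ⟨f ⟨z, hz⟩, (f _).2, ?_⟩
    rw [← h _ ⟨z, hz⟩, Function.comp_apply]
    congr 2
    exact Subtype.ext hzα

end Addresses

/-! ### Hölder estimates between attractors. -/

section Holder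

open Set Filter Topology

variable {m : ℕ} {S S' : Fin m → ℂ → ℂ} {K K' : Set ℂ} {π : (ℕ → Fin m) → K}
  {π' : (ℕ → Fin m) → K'} {q q' : Fin m → ℝ} {r : ℝ}

/-- As `r` decreases to `0`, `q i ^ r` tends to `1`, which exceeds `q' i`. -/
theorem exists_rpow_exponent {ι : Type*} [Finite ι] {q q' : ι → ℝ} (hq : ∀ i, 0 < q i)
    (hq' : ∀ i, q' i < 1) : ∃ r : ℝ, 0 < r ∧ r ≤ 1 ∧ ∀ i, q' i ≤ q i ^ r := by
  have h : ∀ᶠ r : ℝ in 𝓝[>] 0, ∀ i, q' i ≤ q i ^ r := by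
    refine eventually_all.2 fun i => ?_
    have : Tendsto (fun r : ℝ => q i ^ r) (𝓝[>] 0) (𝓝 1) := by
      have := (Real.continuousAt_const_rpow (hq i).ne' (b := 0)).tendsto
      rw [Real.rpow_zero] at this
      exact this.mono_left nhdsWithin_le_nhds
    exact (this.eventually_const_lt (hq' i)).mono fun _ h => h.le
  obtain ⟨r, hr, hr'⟩ := (h.and (Ioc_mem_nhdsGT one_pos)).exists
  exact ⟨r, hr'.1, hr'.2, hr⟩

theorem mul_rpow_dist_le {T : ℂ → ℂ} {q q' r : ℝ} (hq : 0 < q)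
    (hT : ∀ x y, dist (T x) (T y) = q * dist x y) (hr : q' ≤ q ^ r) {C : ℝ} (hC : 0 ≤ C)
    (x y : ℂ) : q' * (C * dist x y ^ r) ≤ C * dist (T x) (T y) ^ r := by
  rw [hT, Real.mul_rpow hq.le dist_nonneg, mul_left_comm]
  gcongr

/-- The Hölder estimate at the points of a finite set `V` whose points are visible only from the
pieces of the attractor that have them among their own images of `V`. -/
theorem exists_dist_vertex_le (hK : IsAttractor S K) (hK' : IsAttractor S' K')
    (hπ : IsAddressMap S K π) (hπ' : IsAddressMap S' K' π') (hSc : ∀ i, Continuous (S i))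
    (hq0 : ∀ i, 0 < q i) (hq : ∀ i x y, dist (S i x) (S i y) = q i * dist x y)
    (hq0' : ∀ i, 0 < q' i) (hq1' : ∀ i, q' i < 1)
    (hq' : ∀ i x y, dist (S' i x) (S' i y) = q' i * dist x y) (hr0 : 0 < r)
    (hr : ∀ i, q' i ≤ q i ^ r) {V : Set ℂ} (hV : V.Finite)
    (hVS : ∀ i, ∀ v ∈ V, v ∈ S i '' K → v ∈ S i '' V) {f : ℂ → ℂ} (hfK : MapsTo f V K')
    (hf : ∀ i, ∀ v ∈ V, f (S i v) = S' i (f v)) :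
    ∃ C : ℝ, 0 ≤ C ∧ ∀ α, ∀ v ∈ V, dist (π' α : ℂ) (f v) ≤ C * dist (π α : ℂ) v ^ r := by
  obtain ⟨D, hD⟩ := Metric.isBounded_iff.1 hK'.isCompact.isBounded
  have hD0 : 0 ≤ D := by
    obtain ⟨z, hz⟩ := hK'.nonempty
    exact dist_nonneg.trans (hD hz hz)
  have hd : ∀ᶠ d : ℝ in 𝓝[>] 0, ∀ i, ∀ v ∈ V, v ∉ S i '' K → ∀ x ∈ S i '' K, d ≤ dist x v := by
    refine eventually_all.2 fun i => (eventually_all_finite hV).2 fun v _ => ?_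
    by_cases hv : v ∈ S i '' K
    · exact .of_forall fun _ h => (h hv).elim
    obtain ⟨d, hd, h⟩ := (hK.isCompact.image (hSc i)).exists_pos_forall_le_dist
      (isClosed_singleton (x := v)) (disjoint_singleton_right.2 hv)
    filter_upwards [Ioc_mem_nhdsGT hd] with e he _ x hx
    exact he.2.trans (h x hx v rfl)
  obtain ⟨d, hd, hd0⟩ := (hd.and self_mem_nhdsWithin).exists
  have hdr : 0 < d ^ r := Real.rpow_pos_of_pos hd0 r
  -- With this constant the estimate is trivial at distance at least `d`.
  set C := D / d ^ r
  have hC : 0 ≤ C := by positivity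
  refine ⟨C, hC, fun α v hv => ?_⟩
  have : Nonempty (Fin m) := ⟨α 0⟩
  obtain ⟨i₀, hi₀⟩ := Finite.exists_max q'
  -- Peeling need not stop, so `n` steps leave an error that tends to `0`, while `C` stays the same.
  have key : ∀ n : ℕ, ∀ α, ∀ v ∈ V,
      dist (π' α : ℂ) (f v) ≤ C * dist (π α : ℂ) v ^ r + q' i₀ ^ n * D := by
    intro n
    induction n with
    | zero =>
      intro α v hv
      have := hD (π' α).2 (hfK hv)
      have : 0 ≤ C * dist (π α : ℂ) v ^ r := by positivity
      linarith
    | succ n ih =>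
      intro α v hv
      by_cases hvK : v ∈ S (α 0) '' K
      · obtain ⟨u, hu, rfl⟩ := hVS _ v hv hvK
        rw [hf _ u hu, ← hπ'.apply_shift hK', hq', ← hπ.apply_shift hK]
        calc q' (α 0) * dist (π' (wordShift α) : ℂ) (f u)
            ≤ q' (α 0) * (C * dist (π (wordShift α) : ℂ) u ^ r + q' i₀ ^ n * D) :=
              mul_le_mul_of_nonneg_left (ih _ u hu) (hq0' _).le
          _ = q' (α 0) * (C * dist (π (wordShift α) : ℂ) u ^ r) +
              q' (α 0) * (q' i₀ ^ n * D) := mul_add ..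
          _ ≤ C * dist (S (α 0) (π (wordShift α))) (S (α 0) u) ^ r +
              q' i₀ * (q' i₀ ^ n * D) := by
            have := (hq0' i₀).le
            refine add_le_add (mul_rpow_dist_le (hq0 _) (hq _) (hr _) hC _ _) ?_
            exact mul_le_mul_of_nonneg_right (hi₀ _) (by positivity)
          _ = _ := by rw [pow_succ', mul_assoc]
      · have h₁ : d ≤ dist (π α : ℂ) v :=
          hd _ v hv hvK _ (hπ.apply_shift hK α ▸ mem_image_of_mem _ (π _).2)
        have h₂ : d ^ r ≤ dist (π α : ℂ) v ^ r := Real.rpow_le_rpow hd0.le h₁ hr0.le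
        have := (hq0' i₀).le
        calc dist (π' α : ℂ) (f v) ≤ D := hD (π' α).2 (hfK hv)
          _ = C * d ^ r := by rw [div_mul_cancel₀ _ hdr.ne']
          _ ≤ C * dist (π α : ℂ) v ^ r := by gcongr
          _ ≤ _ := le_add_of_nonneg_right (by positivity)
  have hlim : Tendsto (fun n : ℕ => C * dist (π α : ℂ) v ^ r + q' i₀ ^ n * D) atTop
      (𝓝 (C * dist (π α : ℂ) v ^ r)) := by
    simpa using ((tendsto_pow_atTop_nhds_zero_of_lt_one (hq0' i₀).le (hq1' i₀)).mul_const
      D).const_add (C * dist (π α : ℂ) v ^ r)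
  exact ge_of_tendsto' hlim fun n => key n α v hv

/-- The Hölder estimate for the correspondence `π α ↦ π' α` between two attractors whose pieces
are either disjoint or meet transversally at a point of `V`. -/
theorem exists_dist_address_le (hK : IsAttractor S K) (hK' : IsAttractor S' K')
    (hπ : IsAddressMap S K π) (hπ' : IsAddressMap S' K' π') (hSc : ∀ i, Continuous (S i))
    (hq0 : ∀ i, 0 < q i) (hq : ∀ i x y, dist (S i x) (S i y) = q i * dist x y)
    (hq0' : ∀ i, 0 < q' i) (hq1' : ∀ i, q' i < 1)
    (hq' : ∀ i x y, dist (S' i x) (S' i y) = q' i * dist x y) (hr0 : 0 < r)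
    (hr : ∀ i, q' i ≤ q i ^ r) {V : Set ℂ} (hV : V.Finite)
    (hVS : ∀ i, ∀ v ∈ V, v ∈ S i '' K → v ∈ S i '' V) {f : ℂ → ℂ} (hfK : MapsTo f V K')
    (hf : ∀ i, ∀ v ∈ V, f (S i v) = S' i (f v))
    (hS : ∀ i j, i ≠ j → Disjoint (S i '' K) (S j '' K) ∨
      ∃ v ∈ V, ∃ u ∈ V, S i v = S j u ∧ SeparatedAt (S i v) (S i '' K) (S j '' K)) :
    ∃ C : ℝ, 0 ≤ C ∧ ∀ α β, dist (π' α : ℂ) (π' β) ≤ C * dist (π α : ℂ) (π β) ^ r := by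
  obtain ⟨D, hD⟩ := Metric.isBounded_iff.1 hK'.isCompact.isBounded
  have hD0 : 0 ≤ D := by
    obtain ⟨z, hz⟩ := hK'.nonempty
    exact dist_nonneg.trans (hD hz hz)
  obtain ⟨B, hB0, hB⟩ := exists_dist_vertex_le hK hK' hπ hπ' hSc hq0 hq hq0' hq1' hq' hr0 hr hV
    hVS hfK hf
  have hmem : ∀ α, (π α : ℂ) ∈ S (α 0) '' K := fun α =>
    hπ.apply_shift hK α ▸ mem_image_of_mem _ (π _).2
  have near : ∀ α, ∀ v ∈ V,
      dist (π' α : ℂ) (S' (α 0) (f v)) ≤ B * dist (π α : ℂ) (S (α 0) v) ^ r := by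
    intro α v hv
    rw [← hπ'.apply_shift hK', hq', ← hπ.apply_shift hK]
    exact (mul_le_mul_of_nonneg_left (hB _ v hv) (hq0' _).le).trans
      (mul_rpow_dist_le (hq0 _) (hq _) (hr _) hB0 _ _)
  have h : ∀ i j, ∀ᶠ C : ℝ in atTop, i ≠ j → ∀ α β, α 0 = i → β 0 = j →
      dist (π' α : ℂ) (π' β) ≤ C * dist (π α : ℂ) (π β) ^ r := by
    intro i j
    by_cases hij : i = j
    · exact .of_forall fun _ h => (h hij).elim
    suffices ∃ C : ℝ, ∀ α β, α 0 = i → β 0 = j →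
        dist (π' α : ℂ) (π' β) ≤ C * dist (π α : ℂ) (π β) ^ r by
      obtain ⟨C, hC⟩ := this
      filter_upwards [eventually_ge_atTop C] with C' hC' _ α β hα hβ
      exact (hC α β hα hβ).trans (by gcongr)
    rcases hS i j hij with hdis | ⟨v, hv, u, hu, hvu, c, hc⟩
    · obtain ⟨d, hd0, hd⟩ := (hK.isCompact.image (hSc i)).exists_pos_forall_le_dist
        (hK.isCompact.image (hSc j)).isClosed hdis
      have hdr : 0 < d ^ r := Real.rpow_pos_of_pos hd0 r
      refine ⟨D / d ^ r, ?_⟩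
      rintro α β rfl rfl
      calc dist (π' α : ℂ) (π' β) ≤ D := hD (π' α).2 (π' β).2
        _ = D / d ^ r * d ^ r := by rw [div_mul_cancel₀ _ hdr.ne']
        _ ≤ _ := by
          gcongr
          exact hd _ (hmem α) _ (hmem β)
    -- Pass through the common point `S i v = S j u`: the first point is within `|c| * x` of it, the
    -- second within `(1 + |c|) * x`.
    · refine ⟨B * |c| ^ r + B * (1 + |c|) ^ r, ?_⟩
      rintro α β rfl rfl
      set x := dist (π α : ℂ) (π β)
      have h₁ : dist (π α : ℂ) (S (α 0) v) ≤ |c| * x :=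
        (hc _ (hmem α) _ (hmem β)).trans (by gcongr; exact le_abs_self c)
      have h₂ : dist (π β : ℂ) (S (β 0) u) ≤ (1 + |c|) * x := by
        rw [← hvu]
        have := dist_triangle_left (π β : ℂ) (S (α 0) v) (π α : ℂ)
        linarith
      have hvu' : S' (α 0) (f v) = S' (β 0) (f u) := by rw [← hf _ v hv, ← hf _ u hu, hvu]
      have hx : 0 ≤ x := dist_nonneg
      calc dist (π' α : ℂ) (π' β)
          ≤ dist (π' α : ℂ) (S' (α 0) (f v)) + dist (π' β : ℂ) (S' (β 0) (f u)) :=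
            hvu' ▸ dist_triangle_right ..
        _ ≤ B * (|c| * x) ^ r + B * ((1 + |c|) * x) ^ r := by
          refine add_le_add ((near α v hv).trans ?_) ((near β u hu).trans ?_) <;> gcongr
        _ = _ := by
          rw [Real.mul_rpow (abs_nonneg c) hx, Real.mul_rpow (by positivity) hx]
          ring
  obtain ⟨C, hC, hC0⟩ := ((eventually_all.2 fun i => eventually_all.2 (h i)).and
    (eventually_ge_atTop (0 : ℝ))).exists
  refine ⟨C, hC0, fun α β => ?_⟩
  by_cases hαβ : α = β
  · subst hαβ
    rw [dist_self, dist_self, Real.zero_rpow hr0.ne', mul_zero]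
  -- Any position of disagreement will do: the induction strips common first letters and stops at
  -- the first disagreement.
  obtain ⟨n, hn⟩ := Function.ne_iff.1 hαβ
  clear hαβ
  induction n generalizing α β with
  | zero => exact hC _ _ hn α β rfl rfl
  | succ n ih =>
    by_cases h0 : α 0 = β 0
    · rw [← hπ'.apply_shift hK' α, ← hπ'.apply_shift hK' β, ← hπ.apply_shift hK α,
        ← hπ.apply_shift hK β, ← h0, hq']
      exact (mul_le_mul_of_nonneg_left (ih (wordShift α) (wordShift β) hn) (hq0' _).le).trans
        (mul_rpow_dist_le (hq0 _) (hq _) (hr _) hC0 _ _)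
    · exact hC _ _ h0 α β rfl rfl

end Holder

/-! ### Polygonal systems and their deformations. -/

section PolygonalSystems

open Set Filter Topology

variable {m n n' : ℕ} {P : Polygon ℂ n} {P' : Polygon ℂ n'} {S S' : Fin m → ℂ → ℂ} {K K' : Set ℂ}

theorem finite_polygonVertices (P : Polygon ℂ n) : (polygonVertices P).Finite :=
  finite_range _

theorem IsGeneralizedPolygonalSystem.vertices_subset_attractor
    (hS : IsGeneralizedPolygonalSystem P S) (hK : IsAttractor S K) : polygonVertices P ⊆ K :=
  subset_of_subset_iUnion_image hS.similarity (finite_polygonVertices P).isBounded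
    hS.vertices_subset hK.isCompact.isClosed hK.nonempty fun i _ hx => hK.mem i hx

theorem IsContractiblePolygonalSystem.attractor_subset
    (hS : IsContractiblePolygonalSystem P S) (hK : IsAttractor S K) : K ⊆ polygonRegion P :=
  subset_of_subset_iUnion_image hS.similarity hK.isCompact.isBounded hK.eq_iUnion.subset
    (isClosed_polygonRegion P)
    ⟨_, polygonVertices_subset_polygonRegion P
      (mem_range_self ⟨0, by have := hS.simple.three_le; omega⟩)⟩
    fun i => mapsTo_iff_image_subset.2 (hS.image_subset i)

/-- Some `S k` has `v` among its vertex images. If `k ≠ i`, then `K ⊆ polygonRegion P` puts `v` in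
two pieces of the polygon, which meet only in common vertices. -/
theorem IsContractiblePolygonalSystem.mem_image_vertices (hS : IsContractiblePolygonalSystem P S)
    (hK : IsAttractor S K) {i : Fin m} {v : ℂ} (hv : v ∈ polygonVertices P)
    (hi : v ∈ S i '' K) : v ∈ S i '' polygonVertices P := by
  obtain ⟨k, hk⟩ := mem_iUnion.1 (hS.vertices_subset hv)
  by_cases hki : k = i
  · exact hki ▸ hk
  · exact ((hS.inter_eq k i hki).subset
      ⟨image_mono (polygonVertices_subset_polygonRegion P) hk,
        image_mono (hS.attractor_subset hK) hi⟩).2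

/-- Here `K` is not assumed to lie in the polygon; the intersection condition takes over that role.
-/
theorem IsGeneralizedPolygonalSystem.mem_image_vertices (hS : IsGeneralizedPolygonalSystem P S)
    (hK : IsAttractor S K) (hI : IntersectionCondition P S K) {i : Fin m} {v : ℂ}
    (hv : v ∈ polygonVertices P) (hi : v ∈ S i '' K) : v ∈ S i '' polygonVertices P := by
  obtain ⟨k, hk⟩ := mem_iUnion.1 (hS.vertices_subset hv)
  by_cases hki : k = i
  · exact hki ▸ hk
  · have h := (hI k i hki).trans (hS.inter_eq k i hki)
    exact (h.subset ⟨image_mono (hS.vertices_subset_attractor hK) hk, hi⟩).2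

theorem IsContractiblePolygonalSystem.disjoint_or_separatedAt
    (hS : IsContractiblePolygonalSystem P S) (hK : IsAttractor S K) {i j : Fin m} (hij : i ≠ j) :
    Disjoint (S i '' K) (S j '' K) ∨ ∃ v ∈ polygonVertices P, ∃ u ∈ polygonVertices P,
      S i v = S j u ∧ SeparatedAt (S i v) (S i '' K) (S j '' K) := by
  have hKP := fun k => image_mono (f := S k) (hS.attractor_subset hK)
  have h := hS.inter_eq i j hij
  have hcard : (S i '' polygonVertices P ∩ S j '' polygonVertices P).encard ≤ 1 :=
    Order.le_of_lt_add_one (by simpa [one_add_one_eq_two] using hS.encard_lt i j hij)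
  rcases encard_le_one_iff_eq.1 hcard with h0 | ⟨p, hp⟩
  · exact .inl ((disjoint_iff_inter_eq_empty.2 (h.trans h0)).mono (hKP i) (hKP j))
  · obtain ⟨⟨v, hv, hvp⟩, ⟨u, hu, hup⟩⟩ := hp.symm.subset (mem_singleton p)
    refine .inr ⟨v, hv, u, hu, hvp.trans hup.symm, ?_⟩
    rw [hvp]
    exact (separatedAt_image_polygonRegion (hS.similarity i) (hS.similarity j)
      (h.trans hp)).mono (hKP i) (hKP j)

theorem IsContractiblePolygonalSystem.exists_dist_address_le {δ : ℝ}
    (hS : IsContractiblePolygonalSystem P S) (hS' : IsDeformation δ P S P' S')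
    (hK : IsAttractor S K) (hK' : IsAttractor S' K') {π : (ℕ → Fin m) → K}
    {π' : (ℕ → Fin m) → K'} (hπ : IsAddressMap S K π) (hπ' : IsAddressMap S' K' π') :
    ∃ C r : ℝ≥0, 0 < r ∧ r ≤ 1 ∧
      ∀ α β, dist (π' α : ℂ) (π' β) ≤ C * dist (π α : ℂ) (π β) ^ (r : ℝ) := by
  have hG' := hS'.generalized
  obtain ⟨f, -, hfV, -, -, hf⟩ := hS'.exists_map
  choose q hq0 hq1 hq using hS.similarity
  choose q' hq0' hq1' hq' using hG'.similarity
  obtain ⟨r, hr0, hr1, hr⟩ := exists_rpow_exponent hq0 hq1'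
  obtain ⟨C, hC0, hC⟩ := _root_.exists_dist_address_le hK hK' hπ hπ'
    (fun i => (hS.similarity i).continuous) hq0 hq hq0' hq1' hq' hr0 hr (finite_polygonVertices P)
    (fun _ _ hv hi => hS.mem_image_vertices hK hv hi)
    (fun v hv => hG'.vertices_subset_attractor hK' (hfV ▸ mem_image_of_mem f hv)) hf
    (fun _ _ hij => hS.disjoint_or_separatedAt hK hij)
  exact ⟨⟨C, hC0⟩, ⟨r, hr0.le⟩, hr0, hr1, hC⟩

/-- If the pieces of the deformed attractor meet only where the polygons do, then addresses of the
same point of the deformed attractor are addresses of the same point of the original one. -/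
theorem IsDeformation.address_eq {δ : ℝ} (hS : IsContractiblePolygonalSystem P S)
    (hS' : IsDeformation δ P S P' S')
    (hK : IsAttractor S K) (hK' : IsAttractor S' K') {π : (ℕ → Fin m) → K}
    {π' : (ℕ → Fin m) → K'} (hπ : IsAddressMap S K π) (hπ' : IsAddressMap S' K' π')
    (hI : IntersectionCondition P' S' K') {α β : ℕ → Fin m} (h : π' α = π' β) : π α = π β := by
  have hG' := hS'.generalized
  obtain ⟨f, hfb, hfV, -, -, hf⟩ := hS'.exists_map
  have vertex : ∀ γ, ∀ v ∈ polygonVertices P, f v = π' γ → v = π γ := by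
    intro γ v hv hvγ
    -- The relation passes to the shifted word: `f v` is the `S' (γ 0)`-image of some `f u`, and
    -- injectivity of `f` on the vertices of the pieces turns this into `v = S (γ 0) u`.
    refine hπ.eq_of_rel (R := fun γ v => v ∈ polygonVertices P ∧ f v = π' γ)
      (fun _ _ h => hS.vertices_subset_attractor hK h.1) ?_ ⟨hv, hvγ⟩
    rintro γ v ⟨hv, hvγ⟩
    have hs := hπ'.apply_shift hK' γ
    have hmem : f v ∈ S' (γ 0) '' polygonVertices P' :=
      hG'.mem_image_vertices hK' hI (hfV ▸ mem_image_of_mem f hv)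
        (hvγ ▸ hs ▸ mem_image_of_mem _ (π' _).2)
    rw [← hfV] at hmem
    obtain ⟨_, ⟨u, hu, rfl⟩, huv⟩ := hmem
    refine ⟨u, ⟨hu, (hG'.similarity (γ 0)).injective ?_⟩, ?_⟩
    · rw [huv, hvγ, hs]
    · exact hfb.injOn (mem_iUnion.2 ⟨_, mem_image_of_mem _ hu⟩) (hS.vertices_subset hv)
        ((hf _ u hu).trans huv)
  have base : ∀ α β : ℕ → Fin m, α 0 ≠ β 0 → π' α = π' β → π α = π β := by
    intro α β hαβ h
    have hα : (π' α : ℂ) ∈ S' (α 0) '' K' :=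
      hπ'.apply_shift hK' α ▸ mem_image_of_mem _ (π' _).2
    have hβ : (π' α : ℂ) ∈ S' (β 0) '' K' :=
      h ▸ hπ'.apply_shift hK' β ▸ mem_image_of_mem _ (π' _).2
    have hV := ((hI _ _ hαβ).trans (hG'.inter_eq _ _ hαβ)).subset ⟨hα, hβ⟩
    rw [← hfV] at hV
    obtain ⟨⟨_, ⟨v, hv, rfl⟩, hvα⟩, ⟨_, ⟨u, hu, rfl⟩, huβ⟩⟩ := hV
    have h₁ : f v = π' (wordShift α) := (hG'.similarity (α 0)).injective <| by
      rw [hvα, hπ'.apply_shift hK']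
    have h₂ : f u = π' (wordShift β) := (hG'.similarity (β 0)).injective <| by
      rw [huβ, hπ'.apply_shift hK', h]
    refine Subtype.ext ?_
    rw [← hπ.apply_shift hK α, ← hπ.apply_shift hK β, ← vertex _ v hv h₁, ← vertex _ u hu h₂]
    refine hfb.injOn (mem_iUnion.2 ⟨_, mem_image_of_mem _ hv⟩)
      (mem_iUnion.2 ⟨_, mem_image_of_mem _ hu⟩) ?_
    rw [hf _ v hv, hf _ u hu, hvα, huβ]
  have step : ∀ n : ℕ, ∀ α β : ℕ → Fin m, α n ≠ β n → π' α = π' β → π α = π β := by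
    intro n
    induction n with
    | zero => exact base
    | succ n ih =>
      intro α β hαβ h
      by_cases h0 : α 0 = β 0
      · refine Subtype.ext ?_
        rw [← hπ.apply_shift hK α, ← hπ.apply_shift hK β, ← h0,
          ih (wordShift α) (wordShift β) hαβ]
        refine Subtype.ext ((hG'.similarity (α 0)).injective ?_)
        rw [hπ'.apply_shift hK', h0, hπ'.apply_shift hK', h]
      · exact base α β h0 h
  by_cases hαβ : α = β
  · rw [hαβ]
  · obtain ⟨n, hn⟩ := Function.ne_iff.1 hαβ
    exact step n α β hn h

end PolygonalSystems

/-! ### The main theorem. -/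

theorem theorem14 {m n n' : ℕ} (P : Polygon ℂ n) (P' : Polygon ℂ n') (S S' : Fin m → ℂ → ℂ)
    (δ : ℝ) (hS : IsContractiblePolygonalSystem P S) (hS' : IsDeformation δ P S P' S')
    (K K' : Set ℂ) (hK : IsAttractor S K) (hK' : IsAttractor S' K')
    (π : (ℕ → Fin m) → K) (π' : (ℕ → Fin m) → K')
    (hπ : IsAddressMap S K π) (hπ' : IsAddressMap S' K' π') :
    (∃! f : K → K', Continuous f ∧ f ∘ π = π') ∧
    (∃! f : K → K', Continuous f ∧ Intertwines S' hK f) ∧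
    (∀ f : K → K', Continuous f → (f ∘ π = π' ↔ Intertwines S' hK f)) ∧
    (∀ f : K → K', Continuous f → f ∘ π = π' →
      (∃ C r : ℝ≥0, 0 < r ∧ r ≤ 1 ∧ HolderWith C r f) ∧
      (IntersectionCondition P' S' K' → IsHomeomorph f)) := by
  have hsurj := hπ.surjective hK
  obtain ⟨C, r, hr0, hr1, hCr⟩ := hS.exists_dist_address_le hS' hK hK' hπ hπ'
  have holder : ∀ f : K → K', f ∘ π = π' → HolderWith C r f := by
    intro f hf x y
    obtain ⟨α, rfl⟩ := hsurj x
    obtain ⟨β, rfl⟩ := hsurj y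
    have h := hCr α β
    rw [← hf] at h
    rw [edist_nndist, edist_nndist, ← ENNReal.coe_rpow_of_nonneg _ r.coe_nonneg, ← ENNReal.coe_mul,
      ENNReal.coe_le_coe]
    exact_mod_cast h
  have exists_unique : ∃! f : K → K', Continuous f ∧ f ∘ π = π' := by
    -- Any choice of address works: at distance `0` the Hölder bound forces equal values of `π'`.
    have hf : (fun x => π' (Function.surjInv hsurj x)) ∘ π = π' := by
      funext α
      refine Subtype.ext (dist_le_zero.1 ((hCr _ α).trans_eq ?_))
      rw [Function.surjInv_eq hsurj, dist_self, Real.zero_rpow (by exact_mod_cast hr0.ne'),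
        mul_zero]
    exact ⟨_, ⟨(holder _ hf).continuous hr0, hf⟩,
      fun g hg => hsurj.injective_comp_right (hg.2.trans hf.symm)⟩
  have hiff := comp_eq_iff_intertwines hK hK' hπ hπ'
  refine ⟨exists_unique, by simpa only [hiff] using exists_unique, fun f _ => hiff f,
    fun f hfc hf => ⟨⟨C, r, hr0, hr1, holder f hf⟩, fun hI => ?_⟩⟩
  have : CompactSpace K := isCompact_iff_compactSpace.1 hK.isCompact
  refine isHomeomorph_iff_continuous_bijective.2 ⟨hfc, fun x y hxy => ?_, ?_⟩
  · obtain ⟨α, rfl⟩ := hsurj x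
    obtain ⟨β, rfl⟩ := hsurj y
    refine hS'.address_eq hS hK hK' hπ hπ' hI ?_
    rwa [← hf]
  · refine Function.Surjective.of_comp (g := π) ?_
    rw [hf]
    exact hπ'.surjective hK'
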